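/- Let $n\in\mathbb N$, $T>0$, let $H=H(t,p)$ be a real function of class $C^1$ on $[0,T]\times\mathbb R^n$ and let $\sigma:\mathbb R^n\to\mathbb R$ be convex and of class $C^1$. Let $\sigma^*(q)=\sup_{y\in\mathbb R^n}\{\langle y,q\rangle-\sigma(y)\}\in(-\infty,+\infty]$ be the Fenchel conjugate of $\sigma$, and put $$\varphi(t,x,q)=\langle x,q\rangle-\sigma^*(q)-\int_0^tH(\tau,q)\,d\tau,\qquad u(t,x)=\max_{q\in\mathbb R^n}\varphi(t,x,q)$$ (the Hopf-type formula for the Cauchy problem $u_t+H(t,D_xu)=0$, $u(0,\cdot)=\sigma$). Let $\ell(t,x)$ be the set of all $p\in\mathbb R^n$ at which $\varphi(t,x,\cdot)$ attains its maximum. Assume: (A1) for every $(t_0,x_0)\in[0,T)\times\mathbb R^n$ there are $r,N>0$ such that $\varphi(t,x,p)<\max_{|q|\le N}\varphi(t,x,q)$ whenever $(t,x)\in[0,T)\times\mathbb R^n$, $|t-t_0|+|x-x_0|<r$ and $|p|>N$; (A2) either (a) $H(t,\cdot)$ is convex for all $t\in(0,T)$, or $H(t,\cdot)$ is concave for all $t\in(0,T)$;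 or (b) $H(t,p)=g(t)h(p)+k(t)$ for $t\in(0,T)$, $p\in\mathbb R^n$, with some functions $g,h,k$ such that $g\ge0$ on $(0,T)$ or $g\le0$ on $(0,T)$; and that $\sigma$ is Lipschitz on $\mathbb R^n$. Let $0<t_*\le T$ and suppose that $\ell(t_*,x)$ is a singleton for every $x\in\mathbb R^n$. Then on the open strip $(0,t_*)\times\mathbb R^n$ the maximum defining $u$ is attained and finite, and $u$ is continuously differentiable there. -/

import Mathlib

noncomputable section

/-- The Fenchel conjugate `σ*(q) = sup_y (⟨y, q⟩ - σ(y))`, with values in `[-∞, +∞]`. -/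
def fenchelConj {n : ℕ} (σ : EuclideanSpace ℝ (Fin n) → ℝ)
    (q : EuclideanSpace ℝ (Fin n)) : EReal :=
  ⨆ y : EuclideanSpace ℝ (Fin n), ((inner ℝ y q - σ y : ℝ) : EReal)

/-- `φ(t,x,q) = ⟨x, q⟩ - σ*(q) - ∫₀ᵗ H(τ,q) dτ`, which is `-∞` exactly when `σ*(q) = +∞`.
The finite terms are collected first; as `σ*` never takes the value `-∞`, the subtraction
in `EReal` is never of the form `∞ - ∞`. -/
def hopfPhi {n : ℕ} (H : ℝ → EuclideanSpace ℝ (Fin n) → ℝ) (σ : EuclideanSpace ℝ (Fin n) → ℝ)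
    (t : ℝ) (x q : EuclideanSpace ℝ (Fin n)) : EReal :=
  ((inner ℝ x q - ∫ τ in (0 : ℝ)..t, H τ q : ℝ) : EReal) - fenchelConj σ q

/-- The set `ℓ(t,x)` of all points at which `φ(t,x,·)` attains its maximum over `ℝⁿ`. -/
def hopfMaximizers {n : ℕ} (H : ℝ → EuclideanSpace ℝ (Fin n) → ℝ)
    (σ : EuclideanSpace ℝ (Fin n) → ℝ) (t : ℝ) (x : EuclideanSpace ℝ (Fin n)) :
    Set (EuclideanSpace ℝ (Fin n)) :=
  {p | ∀ q, hopfPhi H σ t x q ≤ hopfPhi H σ t x p}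

/-- The Hopf-type formula `u(t,x) = max_q φ(t,x,q)`, as a real number
(meaningful where the supremum is finite). -/
def hopfU {n : ℕ} (H : ℝ → EuclideanSpace ℝ (Fin n) → ℝ) (σ : EuclideanSpace ℝ (Fin n) → ℝ)
    (t : ℝ) (x : EuclideanSpace ℝ (Fin n)) : ℝ :=
  (⨆ q : EuclideanSpace ℝ (Fin n), hopfPhi H σ t x q).toReal

/-- Condition (A1): locally uniformly in `(t,x) ∈ [0,T) × ℝⁿ`, the values of `φ(t,x,·)` outside
some ball are smaller than its maximum over that ball. -/
def CondA1 {n : ℕ} (T : ℝ) (H : ℝ → EuclideanSpace ℝ (Fin n) → ℝ)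
    (σ : EuclideanSpace ℝ (Fin n) → ℝ) : Prop :=
  ∀ t₀ ∈ Set.Ico 0 T, ∀ x₀ : EuclideanSpace ℝ (Fin n), ∃ r > (0 : ℝ), ∃ N > (0 : ℝ),
    ∀ t ∈ Set.Ico 0 T, ∀ x : EuclideanSpace ℝ (Fin n), |t - t₀| + ‖x - x₀‖ < r →
      ∀ p : EuclideanSpace ℝ (Fin n), N < ‖p‖ →
        hopfPhi H σ t x p < ⨆ q ∈ Metric.closedBall (0 : EuclideanSpace ℝ (Fin n)) N,
          hopfPhi H σ t x q

/-- Condition (A2): `H(t,·)` is convex for all `t ∈ (0,T)`, or concave for all `t ∈ (0,T)`, or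
`H(t,p) = g(t) h(p) + k(t)` where `g` does not change sign on `(0,T)`. -/
def CondA2 {n : ℕ} (T : ℝ) (H : ℝ → EuclideanSpace ℝ (Fin n) → ℝ) : Prop :=
  ((∀ t ∈ Set.Ioo 0 T, ConvexOn ℝ Set.univ (H t)) ∨
    (∀ t ∈ Set.Ioo 0 T, ConcaveOn ℝ Set.univ (H t))) ∨
  ∃ (g : ℝ → ℝ) (h : EuclideanSpace ℝ (Fin n) → ℝ) (k : ℝ → ℝ),
    (∀ t ∈ Set.Ioo 0 T, ∀ p, H t p = g t * h p + k t) ∧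
    ((∀ t ∈ Set.Ioo 0 T, 0 ≤ g t) ∨ (∀ t ∈ Set.Ioo 0 T, g t ≤ 0))

end

open Set Filter Topology MeasureTheory
open scoped RealInnerProductSpace

/-!
The Lipschitz bound on `σ` confines the domain of `σ*` to a ball, so the Hopf maximum is attained.
Write `F t = ∫₀ᵗ H`. Uniqueness of the maximizer at the final time `T`, for every `x`, makes
`v x = max_q (⟨x, q⟩ - σ* q - F T q)` differentiable with gradient the maximizer. Hence `σ* + F T`
is the conjugate of `v`, and so it is convex, although `F T` alone need not be.

Condition (A2) supplies `θ ∈ [0, 1]` with `F t - θ F T` convex: `θ = 0` for convex `H`, `θ = 1` for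
concave `H`, and the ratio of the integrals of `g` for `H = g h + k`. So
`σ* + F t = (1 - θ) σ* + θ (σ* + F T) + (F t - θ F T)` is a sum of convex functions. Both `σ*` and
`σ* + F T` have unique maximizers against every linear functional, the former because `σ` is
differentiable, and since `F t` and `F T` are differentiable this property passes to `σ* + F t`.
By compactness the unique maximizer is continuous in `(t, x)`, and the envelope formula
`Du = ∂φ/∂(t, x)`, evaluated at the maximizer, then shows that `u` is `C¹`.
-/

section Argmax

variable {Q Z : Type*}

/-- The maximizers of `g` over `D`. -/
def argmaxOn (D : Set Q) (g : Q → ℝ) : Set Q :=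
  {p ∈ D | IsMaxOn g D p}

/-- The epigraph of `f` over `D`. It is closed exactly when `f`, extended by `+∞` off `D`, is lower
semicontinuous, a notion that does not ask `D` itself to be closed. -/
def epigraphOn (D : Set Q) (f : Q → ℝ) : Set (Q × ℝ) :=
  {z | z.1 ∈ D ∧ f z.1 ≤ z.2}

variable [TopologicalSpace Q] {D K : Set Q} {f : Q → ℝ}

theorem isClosed_epigraphOn_add {F : Q → ℝ} (hf : IsClosed (epigraphOn D f)) (hF : Continuous F) :
    IsClosed (epigraphOn D fun q => f q + F q) := by
  have hpre : epigraphOn D (fun q => f q + F q) =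
      (fun z : Q × ℝ => (z.1, z.2 - F z.1)) ⁻¹' epigraphOn D f := by
    ext z
    simp only [epigraphOn, mem_ofPred_eq, mem_preimage, le_sub_iff_add_le]
  exact hpre ▸ hf.preimage (by fun_prop)

theorem argmaxOn_sub_nonempty (hf : IsClosed (epigraphOn D f)) (hK : IsCompact K) (hDK : D ⊆ K)
    (hD : D.Nonempty) {b : Q → ℝ} (hb : Continuous b) :
    (argmaxOn D fun q => b q - f q).Nonempty := by
  have hclosed : ∀ c, IsClosed {q ∈ D | f q - b q ≤ c} := fun c => by
    simpa only [epigraphOn, preimage_ofPred_eq, sub_le_iff_le_add] using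
      hf.preimage (by fun_prop : Continuous fun q => (q, c + b q))
  obtain ⟨r, hr⟩ := hD
  set S := {q ∈ D | f q - b q ≤ f r - b r}
  have hS : IsCompact S := hK.of_isClosed_subset (hclosed _) fun q hq => hDK hq.1
  have hlsc : LowerSemicontinuousOn (fun q => f q - b q) S := by
    rw [lowerSemicontinuousOn_iff_preimage_Iic]
    exact fun c => ⟨{q ∈ D | f q - b q ≤ c}, hclosed c,
      Set.ext fun q => and_congr_right fun hq => (and_iff_right hq.1).symm⟩
  obtain ⟨p, hp, hmin⟩ := hlsc.exists_isMinOn (⟨r, hr, le_rfl⟩ : S.Nonempty) hS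
  refine ⟨p, hp.1, fun q hq => ?_⟩
  rcases le_total (f q - b q) (f r - b r) with hqr | hqr
  · have : f p - b p ≤ f q - b q := hmin ⟨hq, hqr⟩
    simp only [mem_ofPred_eq]
    linarith
  · have := hp.2
    simp only [mem_ofPred_eq]
    linarith

theorem continuousOn_argmaxOn_sub [TopologicalSpace Z] (hf : IsClosed (epigraphOn D f))
    (hK : IsCompact K) (hDK : D ⊆ K) {U : Set Z} {b : Z → Q → ℝ}
    (hb : ContinuousOn (fun w : Z × Q => b w.1 w.2) (U ×ˢ univ)) {P : Z → Q}
    (hP : ∀ z ∈ U, argmaxOn D (fun q => b z q - f q) = {P z}) : ContinuousOn P U := by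
  have hmax : ∀ z ∈ U, P z ∈ argmaxOn D fun q => b z q - f q := fun z hz => by simp [hP z hz]
  intro z hz
  refine hK.tendsto_nhds_of_unique_mapClusterPt
    (eventually_nhdsWithin_of_forall fun w hw => hDK (hmax w hw).1) fun q _ hq => ?_
  obtain ⟨V, hV, hVq⟩ := mapClusterPt_iff_ultrafilter.1 hq
  have hVU : ∀ᶠ w in (V : Filter Z), w ∈ U := hV self_mem_nhdsWithin
  have hVz : Tendsto (fun w => w) (V : Filter Z) (𝓝 z) := hV.trans nhdsWithin_le_nhds
  have hb_lim : ∀ {R : Z → Q} {r : Q}, Tendsto R V (𝓝 r) →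
      Tendsto (fun w => b w (R w)) V (𝓝 (b z r)) := fun {R r} hR =>
    (hb (z, r) ⟨hz, mem_univ r⟩).tendsto.comp <| tendsto_nhdsWithin_iff.2
      ⟨hVz.prodMk_nhds hR, hVU.mono fun w hw => ⟨hw, mem_univ _⟩⟩
  -- The inequality `f (P w) ≤ b w (P w) - b w r + f r` survives the limit `P w → q` because the
  -- epigraph is closed.
  have hlim : ∀ r ∈ D, (q, b z q - b z r + f r) ∈ epigraphOn D f := fun r hr =>
    hf.mem_of_tendsto
      (hVq.prodMk_nhds (((hb_lim hVq).sub (hb_lim tendsto_const_nhds)).add_const (f r)))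
      (hVU.mono fun w hw => ⟨(hmax w hw).1, by
        have : b w r - f r ≤ b w (P w) - f (P w) := (hmax w hw).2 hr
        linarith⟩)
  have hq_mem : q ∈ argmaxOn D fun q => b z q - f q := by
    refine ⟨(hlim _ (hmax z hz).1).1, fun r hr => ?_⟩
    have := (hlim r hr).2
    simp only [mem_ofPred_eq] at this ⊢
    linarith
  simpa [hP z hz] using hq_mem

end Argmax

section Danskin

variable {Q Z : Type*} [TopologicalSpace Q] [NormedAddCommGroup Z] [NormedSpace ℝ Z]
  {D : Set Q} {U : Set Z} {Φ : Z → Q → ℝ} {Φ' : Z → Q → Z →L[ℝ] ℝ} {P : Z → Q}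

theorem hasFDerivAt_of_mem_argmaxOn (hU : IsOpen U)
    (hΦ : ∀ z ∈ U, ∀ q ∈ D, HasFDerivAt (fun w => Φ w q) (Φ' z q) z)
    (hΦ' : ContinuousOn (fun w : Z × Q => Φ' w.1 w.2) (U ×ˢ D))
    (hP : ∀ z ∈ U, P z ∈ argmaxOn D (Φ z)) (hPc : ContinuousOn P U) {z : Z} (hz : z ∈ U) :
    HasFDerivAt (fun w => Φ w (P w)) (Φ' z (P z)) z := by
  rw [hasFDerivAt_iff_isLittleO, Asymptotics.isLittleO_iff]
  intro ε hε
  have hnear : ∀ᶠ w in 𝓝 z ×ˢ 𝓝[D] P z, ‖Φ' w.1 w.2 - Φ' z (P z)‖ < ε := by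
    rw [← hU.nhdsWithin_eq hz, ← nhdsWithin_prod_eq]
    simpa only [dist_eq_norm] using
      (hΦ' (z, P z) ⟨hz, (hP z hz).1⟩).tendsto.eventually (Metric.ball_mem_nhds _ hε)
  obtain ⟨A, hA, B, hB, hAB⟩ := eventually_prod_iff.1 hnear
  obtain ⟨δ, hδ, hball⟩ := Metric.eventually_nhds_iff_ball.1 (hA.and (hU.eventually_mem hz))
  have hmean : ∀ q ∈ D, B q → ∀ w ∈ Metric.ball z δ,
      |Φ w q - Φ z q - Φ' z (P z) (w - z)| ≤ ε * ‖w - z‖ := fun q hqD hqB w hw =>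
    (convex_ball z δ).norm_image_sub_le_of_norm_hasFDerivWithin_le'
      (fun v hv => (hΦ v (hball v hv).2 q hqD).hasFDerivWithinAt)
      (fun v hv => (hAB (hball v hv).1 hqB).le) (Metric.mem_ball_self hδ) hw
  have hPnear : ∀ᶠ w in 𝓝 z, B (P w) :=
    (tendsto_nhdsWithin_iff.2 ⟨hPc.continuousAt (hU.mem_nhds hz),
      (hU.eventually_mem hz).mono fun w hw => (hP w hw).1⟩).eventually hB
  filter_upwards [Metric.ball_mem_nhds z hδ, hPnear] with w hw hBw
  -- Maximality at `z` and at `w` squeezes the increment of the maximum between the increments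
  -- of `Φ` at the fixed points `P z` and `P w`.
  have hlower : Φ w (P z) ≤ Φ w (P w) := (hP w (hball w hw).2).2 (hP z hz).1
  have hupper : Φ z (P w) ≤ Φ z (P z) := (hP z hz).2 (hP w (hball w hw).2).1
  have hz_mean := abs_le.1 (hmean _ (hP z hz).1 (hB.self_of_nhdsWithin (hP z hz).1) w hw)
  have hw_mean := abs_le.1 (hmean _ (hP w (hball w hw).2).1 hBw w hw)
  rw [Real.norm_eq_abs, abs_le]
  constructor <;> linarith [hz_mean.1, hw_mean.2]

theorem contDiffOn_of_mem_argmaxOn (hU : IsOpen U)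
    (hΦ : ∀ z ∈ U, ∀ q ∈ D, HasFDerivAt (fun w => Φ w q) (Φ' z q) z)
    (hΦ' : ContinuousOn (fun w : Z × Q => Φ' w.1 w.2) (U ×ˢ D))
    (hP : ∀ z ∈ U, P z ∈ argmaxOn D (Φ z)) (hPc : ContinuousOn P U) :
    ContDiffOn ℝ 1 (fun w => Φ w (P w)) U := by
  have hderiv := fun z (hz : z ∈ U) => hasFDerivAt_of_mem_argmaxOn hU hΦ hΦ' hP hPc hz
  rw [← zero_add (1 : WithTop ℕ∞), contDiffOn_succ_iff_fderiv_of_isOpen hU, contDiffOn_zero]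
  refine ⟨fun z hz => (hderiv z hz).differentiableAt.differentiableWithinAt, by simp, ?_⟩
  exact (hΦ'.comp (continuousOn_id.prodMk hPc) fun z hz => ⟨hz, (hP z hz).1⟩).congr
    fun z hz => (hderiv z hz).fderiv

end Danskin

section ConvexPerturbation

variable {E : Type*} [NormedAddCommGroup E] {D : Set E} {f G : E → ℝ}

theorem sub_fderiv_le_of_isMinOn_add [NormedSpace ℝ E] {G' : E →L[ℝ] ℝ} {p q : E}
    (hf : ConvexOn ℝ D f) (hG : HasFDerivAt G G' p) (hp : p ∈ D)
    (hmin : IsMinOn (fun r => f r + G r) D p) (hq : q ∈ D) : f p - G' (q - p) ≤ f q := by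
  have hG_line : HasDerivAt (fun r : ℝ => G (AffineMap.lineMap p q r)) (G' (q - p)) 0 :=
    HasFDerivAt.comp_hasDerivAt 0 (by simpa using hG) AffineMap.hasDerivAt_lineMap
  have hslope : ∀ᶠ r : ℝ in 𝓝[>] 0, f p - f q ≤
      r⁻¹ • (G (AffineMap.lineMap p q (0 + r)) - G (AffineMap.lineMap p q (0 : ℝ))) := by
    filter_upwards [Ioo_mem_nhdsGT (zero_lt_one' ℝ)] with r hr
    have hline : AffineMap.lineMap p q r = (1 - r) • p + r • q := AffineMap.lineMap_apply_module ..
    have hconv := hf.2 hp hq (sub_nonneg.2 hr.2.le) hr.1.le (sub_add_cancel 1 r)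
    have hmem := hf.1 hp hq (sub_nonneg.2 hr.2.le) hr.1.le (sub_add_cancel 1 r)
    have hle : f p + G p ≤ f _ + G _ := hmin hmem
    rw [zero_add, hline, AffineMap.lineMap_apply_zero, smul_eq_mul, inv_mul_eq_div,
      le_div_iff₀ hr.1]
    simp only [smul_eq_mul] at hconv
    linarith
  linarith [ge_of_tendsto hG_line.tendsto_slope_zero_right hslope]

theorem midpoint_le_of_convexOn [NormedSpace ℝ E] (hf : ConvexOn ℝ D f) {p q : E} (hp : p ∈ D)
    (hq : q ∈ D) : f (midpoint ℝ p q) ≤ (f p + f q) / 2 := by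
  have := hf.2 hp hq (inv_nonneg.2 zero_le_two) (inv_nonneg.2 zero_le_two) (by norm_num)
  rw [midpoint_eq_smul_add, smul_add, invOf_eq_inv]
  simp only [smul_eq_mul] at this
  linarith

variable [InnerProductSpace ℝ E]

theorem hasGradientAt_inner_right [CompleteSpace E] (q x : E) :
    HasGradientAt (fun w => ⟪w, q⟫) q x :=
  (InnerProductSpace.toDual ℝ E q).hasFDerivAt.congr_of_eventuallyEq <|
    Eventually.of_forall fun w => real_inner_comm q w

theorem mem_argmaxOn_inner_sub_of_add [CompleteSpace E] (hf : ConvexOn ℝ D f) {x p : E}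
    (hG : DifferentiableAt ℝ G p) (hp : p ∈ argmaxOn D fun q => ⟪x, q⟫ - (f q + G q)) :
    p ∈ argmaxOn D fun q => ⟪x - gradient G p, q⟫ - f q := by
  refine ⟨hp.1, fun q hq => ?_⟩
  have hderiv : HasFDerivAt (fun r => G r - innerSL ℝ x r) (fderiv ℝ G p - innerSL ℝ x) p :=
    hG.hasFDerivAt.sub (innerSL ℝ x).hasFDerivAt
  have hmin : IsMinOn (fun r => f r + (G r - innerSL ℝ x r)) D p := fun r hr => by
    have := hp.2 hr
    simp only [mem_ofPred_eq, innerSL_apply_apply] at this ⊢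
    linarith
  have hfirst := sub_fderiv_le_of_isMinOn_add hf hderiv hp.1 hmin hq
  simp only [sub_apply, innerSL_apply_apply, ← inner_gradient_left, ← inner_sub_left] at hfirst
  rw [← neg_sub x, inner_neg_left, inner_sub_right] at hfirst
  simp only [mem_ofPred_eq]
  linarith

theorem inner_midpoint_right (x p q : E) : ⟪x, midpoint ℝ p q⟫ = (⟪x, p⟫ + ⟪x, q⟫) / 2 := by
  rw [midpoint_eq_smul_add, real_inner_smul_right, inner_add_right, invOf_eq_inv]
  ring

-- The midpoint `m` of two maximizers `p`, `q` is a maximizer, so neither convex summand of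
-- `μ • f + ((1 - μ) • f + G)` drops at `m`. Hence `f` is affine on `{p, m, q}`, and the linear
-- functional that `m` maximizes against `f` is also maximized at `p` and at `q`.
theorem subsingleton_argmaxOn_inner_sub_add [CompleteSpace E] (hf : ConvexOn ℝ D f) {μ : ℝ}
    (hμ : 0 < μ) (hfG : ConvexOn ℝ D fun q => (1 - μ) * f q + G q) (hG : Differentiable ℝ G)
    (hf_unique : ∀ y, (argmaxOn D fun q => ⟪y, q⟫ - f q).Subsingleton) (x : E) :
    (argmaxOn D fun q => ⟪x, q⟫ - (f q + G q)).Subsingleton := by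
  intro p hp q hq
  set m := midpoint ℝ p q
  have hmD : m ∈ D := hf.1.midpoint_mem hp.1 hq.1
  have hf_mid : f m ≤ (f p + f q) / 2 := midpoint_le_of_convexOn hf hp.1 hq.1
  have hfG_mid : (1 - μ) * f m + G m ≤ ((1 - μ) * f p + G p + ((1 - μ) * f q + G q)) / 2 :=
    midpoint_le_of_convexOn hfG hp.1 hq.1
  have hx_mid := inner_midpoint_right x p q
  have hpq : ⟪x, p⟫ - (f p + G p) = ⟪x, q⟫ - (f q + G q) := le_antisymm (hq.2 hp.1) (hp.2 hq.1)
  have hpm : ⟪x, m⟫ - (f m + G m) ≤ ⟪x, p⟫ - (f p + G p) := hp.2 hmD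
  have hf_affine : (f p + f q) / 2 ≤ f m := le_of_mul_le_mul_left (by linarith) hμ
  have hm : m ∈ argmaxOn D fun r => ⟪x, r⟫ - (f r + G r) := ⟨hmD, fun r hr => by
    have := mul_le_mul_of_nonneg_left hf_mid hμ.le
    have : ⟪x, r⟫ - (f r + G r) ≤ ⟪x, p⟫ - (f p + G p) := hp.2 hr
    simp only [mem_ofPred_eq]
    linarith⟩
  set y := x - gradient G m
  have hy := mem_argmaxOn_inner_sub_of_add hf (hG m) hm
  have hy_mid := inner_midpoint_right y p q
  have hyp : ⟪y, p⟫ - f p ≤ ⟪y, m⟫ - f m := hy.2 hp.1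
  have hyq : ⟪y, q⟫ - f q ≤ ⟪y, m⟫ - f m := hy.2 hq.1
  have hy_max : ∀ {r}, r ∈ D → ⟪y, m⟫ - f m ≤ ⟪y, r⟫ - f r →
      r ∈ argmaxOn D fun q => ⟪y, q⟫ - f q := fun hr h => ⟨hr, fun z hz => (hy.2 hz).trans h⟩
  exact hf_unique y (hy_max hp.1 (by linarith)) (hy_max hq.1 (by linarith))

end ConvexPerturbation

section UniqueMaximizers

variable {E : Type*} [NormedAddCommGroup E] [InnerProductSpace ℝ E]

theorem convex_forall_inner_sub_le (a : E → ℝ) :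
    Convex ℝ {z : E × ℝ | ∀ y, ⟪y, z.1⟫ - a y ≤ z.2} := by
  simp only [sub_le_comm (b := a _), ofPred_forall]
  exact convex_iInter fun y => convex_halfSpace_le
    (innerSL ℝ y ∘L .fst ℝ E ℝ - ContinuousLinearMap.snd ℝ E ℝ).toLinearMap.isLinear (a y)

variable [ProperSpace E]

theorem exists_gradient_eq_neg_smul {w : E → ℝ} {w' : E → E} {c ε : ℝ}
    (hw : ∀ x, HasGradientAt w (w' x) x) (hc : ∀ x, c ≤ w x) (hε : 0 < ε) :
    ∃ x, w' x = -(ε • x) := by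
  have hw_cont : Continuous w := continuous_iff_continuousAt.2 fun x => (hw x).continuousAt
  have hcoercive : Tendsto (fun x => w x + ε / 2 * ‖x‖ ^ 2) (cocompact E) atTop :=
    tendsto_atTop_add_left_of_le _ c hc <|
      ((tendsto_pow_atTop two_ne_zero).comp tendsto_norm_cocompact_atTop).const_mul_atTop
        (half_pos hε)
  obtain ⟨x, hx⟩ := (by fun_prop : Continuous fun x => w x + ε / 2 * ‖x‖ ^ 2).exists_forall_le
    hcoercive
  refine ⟨x, eq_neg_of_add_eq_zero_left ((InnerProductSpace.toDual ℝ E).injective ?_)⟩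
  have hderiv := (hw x).hasFDerivAt.add
    ((hasStrictFDerivAt_norm_sq x).hasFDerivAt.const_mul (ε / 2))
  rw [map_zero, ← IsLocalMin.hasFDerivAt_eq_zero (Eventually.of_forall hx) hderiv]
  ext y
  simp only [map_add, InnerProductSpace.toDual_apply_apply, add_apply, smul_apply, smul_eq_mul,
    map_smul, innerSL_apply_apply, nsmul_eq_mul]
  ring

variable {D K : Set E} {f : E → ℝ} {P : E → E}

theorem hasGradientAt_of_argmaxOn_inner_sub (hf : IsClosed (epigraphOn D f)) (hK : IsCompact K)
    (hDK : D ⊆ K) (hP : ∀ x, argmaxOn D (fun q => ⟪x, q⟫ - f q) = {P x}) (x : E) :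
    HasGradientAt (fun w => ⟪w, P w⟫ - f (P w)) (P x) x := by
  have hPc : ContinuousOn P univ := continuousOn_argmaxOn_sub hf hK hDK
    (by fun_prop : Continuous fun w : E × E => ⟪w.1, w.2⟫).continuousOn fun z _ => hP z
  exact hasFDerivAt_of_mem_argmaxOn (Φ := fun w q => ⟪w, q⟫ - f q)
    (Φ' := fun _ q => InnerProductSpace.toDual ℝ E q) isOpen_univ
    (fun z _ q _ => (hasGradientAt_inner_right q z).hasFDerivAt.sub_const (f q))
    (by fun_prop) (fun z _ => hP z ▸ mem_singleton _) hPc (mem_univ x)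

-- A minimizer `x` of `v x - ⟪x, p⟫ + ε / 2 * ‖x‖ ^ 2`, where `v x = ⟪x, P x⟫ - f (P x)` has
-- gradient `P x`, satisfies `P x - p = -ε x`. So `P x` tends to `p` as `ε → 0`, with `f (P x) ≤ c`.
theorem mem_epigraphOn_of_forall_inner_sub_le (hf : IsClosed (epigraphOn D f)) (hK : IsCompact K)
    (hDK : D ⊆ K) (hP : ∀ x, argmaxOn D (fun q => ⟪x, q⟫ - f q) = {P x}) {p : E} {c : ℝ}
    (hc : ∀ x, ⟪x, p⟫ - (⟪x, P x⟫ - f (P x)) ≤ c) : (p, c) ∈ epigraphOn D f := by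
  have hmax : ∀ x, P x ∈ argmaxOn D fun q => ⟪x, q⟫ - f q := fun x => hP x ▸ mem_singleton _
  have hgrad : ∀ x, HasGradientAt (fun w => ⟪w, P w⟫ - f (P w) - ⟪w, p⟫) (P x - p) x := fun x => by
    rw [hasGradientAt_iff_hasFDerivAt, map_sub]
    exact (hasGradientAt_of_argmaxOn_inner_sub hf hK hDK hP x).hasFDerivAt.sub
      (hasGradientAt_inner_right p x).hasFDerivAt
  have hlower : ∀ x, f (P 0) ≤ f (P x) := fun x => by
    simpa using (hmax 0).2 (hmax x).1
  have hPc : f (P 0) ≤ c := by simpa using hc 0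
  rw [← hf.closure_eq, Metric.mem_closure_iff]
  intro δ hδ
  have hgap : 0 < c - f (P 0) + 1 := by linarith
  obtain ⟨x, hx⟩ := exists_gradient_eq_neg_smul (c := -c) (ε := δ ^ 2 / (c - f (P 0) + 1)) hgrad
    (fun x => by linarith [hc x]) (by positivity)
  set ε := δ ^ 2 / (c - f (P 0) + 1)
  have hεδ : ε * (c - f (P 0) + 1) = δ ^ 2 := div_mul_cancel₀ _ hgap.ne'
  have hε_pos : 0 < ε := by positivity
  have hfx : f (P x) ≤ c - ε * ‖x‖ ^ 2 := by
    have hinner : ⟪x, P x⟫ - ⟪x, p⟫ = -(ε * ‖x‖ ^ 2) := by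
      rw [← inner_sub_right, hx, inner_neg_right, real_inner_smul_right, real_inner_self_eq_norm_sq]
    linarith [hc x]
  have hnorm : ‖P x - p‖ < δ := by
    refine lt_of_pow_lt_pow_left₀ 2 hδ.le ?_
    calc ‖P x - p‖ ^ 2 = ε * (ε * ‖x‖ ^ 2) := by
          rw [hx, norm_neg, norm_smul, Real.norm_of_nonneg hε_pos.le]; ring
      _ ≤ ε * (c - f (P 0)) := by gcongr; linarith [hlower x]
      _ < δ ^ 2 := by linarith
  exact ⟨(P x, c), ⟨(hmax x).1, hfx.trans (sub_le_self _ (by positivity))⟩,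
    by simpa [Prod.dist_eq, dist_eq_norm, norm_sub_rev, hδ] using hnorm⟩

theorem convexOn_of_argmaxOn_inner_sub (hf : IsClosed (epigraphOn D f)) (hK : IsCompact K)
    (hDK : D ⊆ K) (hP : ∀ x, ∃ p, argmaxOn D (fun q => ⟪x, q⟫ - f q) = {p}) :
    ConvexOn ℝ D f := by
  choose P hP using hP
  have hepi : epigraphOn D f = {z | ∀ x, ⟪x, z.1⟫ - (⟪x, P x⟫ - f (P x)) ≤ z.2} := by
    ext z
    refine ⟨fun hz x => ?_, mem_epigraphOn_of_forall_inner_sub_le hf hK hDK hP⟩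
    have hx : P x ∈ argmaxOn D fun q => ⟪x, q⟫ - f q := hP x ▸ mem_singleton _
    have : ⟪x, z.1⟫ - f z.1 ≤ ⟪x, P x⟫ - f (P x) := hx.2 hz.1
    linarith [hz.2]
  refine convexOn_iff_convex_epigraph.2 (show Convex ℝ (epigraphOn D f) from ?_)
  exact hepi ▸ convex_forall_inner_sub_le _

end UniqueMaximizers

section Conjugate

variable {E : Type*} [NormedAddCommGroup E] [InnerProductSpace ℝ E] {σ : E → ℝ}

/-- The effective domain of the Fenchel conjugate of `σ`: the points where it is finite. -/
def conjDomain (σ : E → ℝ) : Set E :=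
  {q | BddAbove (range fun y => ⟪y, q⟫ - σ y)}

/-- The Fenchel conjugate of `σ` as a real function; off `conjDomain σ` it has a junk value. -/
noncomputable def realConj (σ : E → ℝ) (q : E) : ℝ :=
  ⨆ y, (⟪y, q⟫ - σ y)

theorem inner_sub_le_realConj {q : E} (hq : q ∈ conjDomain σ) (y : E) :
    ⟪y, q⟫ - σ y ≤ realConj σ q :=
  le_ciSup hq y

theorem epigraphOn_realConj (σ : E → ℝ) :
    epigraphOn (conjDomain σ) (realConj σ) = {z | ∀ y, ⟪y, z.1⟫ - σ y ≤ z.2} := by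
  ext z
  exact ⟨fun hz y => (inner_sub_le_realConj hz.1 y).trans hz.2,
    fun hz => ⟨⟨z.2, forall_mem_range.2 hz⟩, ciSup_le hz⟩⟩

theorem isClosed_epigraphOn_realConj (σ : E → ℝ) :
    IsClosed (epigraphOn (conjDomain σ) (realConj σ)) := by
  rw [epigraphOn_realConj, ofPred_forall]
  exact isClosed_iInter fun y => isClosed_le (by fun_prop) continuous_snd

theorem convexOn_realConj (σ : E → ℝ) : ConvexOn ℝ (conjDomain σ) (realConj σ) :=
  convexOn_iff_convex_epigraph.2 <|
    show Convex ℝ (epigraphOn (conjDomain σ) (realConj σ)) from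
      epigraphOn_realConj σ ▸ convex_forall_inner_sub_le σ

theorem norm_le_of_mem_conjDomain {K : NNReal} (hσ : LipschitzWith K σ) {q : E}
    (hq : q ∈ conjDomain σ) : ‖q‖ ≤ K := by
  by_contra! hKq
  have hslope : 0 < ‖q‖ * (‖q‖ - K) := mul_pos (K.coe_nonneg.trans_lt hKq) (sub_pos.2 hKq)
  obtain ⟨r, hr⟩ := exists_nat_gt ((realConj σ q + σ 0) / (‖q‖ * (‖q‖ - K)))
  have hσr : σ ((r : ℝ) • q) ≤ σ 0 + K * (r * ‖q‖) := by
    simpa [norm_smul] using hσ.le_add_mul ((r : ℝ) • q) 0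
  have hconj : r * ‖q‖ ^ 2 - σ ((r : ℝ) • q) ≤ realConj σ q := by
    simpa only [real_inner_smul_left, real_inner_self_eq_norm_sq] using
      inner_sub_le_realConj hq ((r : ℝ) • q)
  rw [div_lt_iff₀ hslope] at hr
  linarith

variable [CompleteSpace E]

theorem inner_gradient_sub_le (hσ : ConvexOn ℝ univ σ) {y : E} (hd : DifferentiableAt ℝ σ y)
    (z : E) : ⟪z, gradient σ y⟫ - σ z ≤ ⟪y, gradient σ y⟫ - σ y := by
  have := sub_fderiv_le_of_isMinOn_add hσ hd.hasFDerivAt.neg (mem_univ y)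
    (fun q _ => by simp) (mem_univ z)
  rw [neg_apply, ← inner_gradient_left, inner_sub_right] at this
  rw [real_inner_comm, real_inner_comm _ y]
  linarith

theorem gradient_mem_conjDomain (hσ : ConvexOn ℝ univ σ) {y : E} (hd : DifferentiableAt ℝ σ y) :
    gradient σ y ∈ conjDomain σ :=
  ⟨_, forall_mem_range.2 (inner_gradient_sub_le hσ hd)⟩

theorem argmaxOn_inner_sub_realConj (hσ : ConvexOn ℝ univ σ) {y : E}
    (hd : DifferentiableAt ℝ σ y) :
    argmaxOn (conjDomain σ) (fun q => ⟪y, q⟫ - realConj σ q) = {gradient σ y} := by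
  have hgrad_conj : realConj σ (gradient σ y) ≤ ⟪y, gradient σ y⟫ - σ y :=
    ciSup_le (inner_gradient_sub_le hσ hd)
  refine Subset.antisymm (fun p hp => ?_) (singleton_subset_iff.2
    ⟨gradient_mem_conjDomain hσ hd, fun q hq => ?_⟩)
  · have hp_grad : ⟪y, gradient σ y⟫ - realConj σ (gradient σ y) ≤ ⟪y, p⟫ - realConj σ p :=
      hp.2 (gradient_mem_conjDomain hσ hd)
    have hmin : IsLocalMin (fun z => σ z - ⟪z, p⟫) y := Eventually.of_forall fun z => by
      have := inner_sub_le_realConj hp.1 z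
      linarith
    have hzero := hmin.hasFDerivAt_eq_zero
      (hd.hasGradientAt.hasFDerivAt.sub (hasGradientAt_inner_right p y).hasFDerivAt)
    exact ((InnerProductSpace.toDual ℝ E).injective (sub_eq_zero.1 hzero)).symm
  · have := inner_sub_le_realConj hq y
    simp only [mem_ofPred_eq]
    linarith

end Conjugate

section EarlierTime

variable {E : Type*} [NormedAddCommGroup E] [InnerProductSpace ℝ E] [ProperSpace E]

theorem subsingleton_argmaxOn_conj_of_later {σ F₀ F₁ : E → ℝ} {K : NNReal}
    (hσ : ConvexOn ℝ univ σ) (hσd : Differentiable ℝ σ) (hσK : LipschitzWith K σ)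
    (hF₀ : Differentiable ℝ F₀) (hF₁ : Differentiable ℝ F₁) {θ : ℝ} (hθ : θ ∈ Icc 0 1)
    (hF : ConvexOn ℝ univ fun q => F₀ q - θ * F₁ q)
    (hunique : ∀ x, ∃ p,
      argmaxOn (conjDomain σ) (fun q => ⟪x, q⟫ - (realConj σ q + F₁ q)) = {p}) (x : E) :
    (argmaxOn (conjDomain σ) fun q => ⟪x, q⟫ - (realConj σ q + F₀ q)).Subsingleton := by
  have hconj := convexOn_realConj σ
  have hF_dom := hF.subset (subset_univ _) hconj.1
  have hlater : ConvexOn ℝ (conjDomain σ) fun q => realConj σ q + F₁ q :=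
    convexOn_of_argmaxOn_inner_sub
      (isClosed_epigraphOn_add (isClosed_epigraphOn_realConj σ) hF₁.continuous)
      (isCompact_closedBall 0 K)
      (fun q hq => mem_closedBall_zero_iff.2 (norm_le_of_mem_conjDomain hσK hq)) hunique
  rcases hθ.1.eq_or_lt with rfl | hθ_pos
  · exact subsingleton_argmaxOn_inner_sub_add hconj one_pos (by simpa using hF_dom) hF₀
      (fun y => argmaxOn_inner_sub_realConj hσ (hσd y) ▸ subsingleton_singleton) x
  · simp only [show ∀ q, realConj σ q + F₀ q = realConj σ q + F₁ q + (F₀ q - F₁ q) by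
      intro q; ring]
    refine subsingleton_argmaxOn_inner_sub_add hlater hθ_pos ?_ (hF₀.sub hF₁)
      (fun y => ?_) x
    · exact ((hconj.smul (sub_nonneg.2 hθ.2)).add hF_dom).congr fun q _ => by
        simp only [Pi.add_apply, Pi.sub_apply, smul_eq_mul]
        ring
    · obtain ⟨p, hp⟩ := hunique y
      exact hp ▸ subsingleton_singleton

end EarlierTime

section Slice

theorem continuousOn_slice {X F : Type*} [TopologicalSpace X] [TopologicalSpace F]
    {f : ℝ → X → F} {s : Set ℝ} (hf : ContinuousOn (fun z : ℝ × X => f z.1 z.2) (s ×ˢ univ))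
    (q : X) : ContinuousOn (fun τ => f τ q) s :=
  hf.comp (f := fun τ => (τ, q)) (Continuous.prodMk_left q).continuousOn
    fun _ hτ => ⟨hτ, mem_univ q⟩

variable {E F : Type*} [NormedAddCommGroup E] [NormedSpace ℝ E] [NormedAddCommGroup F]
  [NormedSpace ℝ F] {f : ℝ → E → F} {s : Set ℝ}

theorem hasFDerivAt_slice (hf : DifferentiableOn ℝ (fun z : ℝ × E => f z.1 z.2) (s ×ˢ univ))
    {τ : ℝ} (hτ : τ ∈ s) (q : E) :
    HasFDerivAt (f τ) (fderivWithin ℝ (fun z : ℝ × E => f z.1 z.2) (s ×ˢ univ) (τ, q) ∘L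
      ContinuousLinearMap.inr ℝ ℝ E) q :=
  hasFDerivWithinAt_univ.1 <|
    (hf (τ, q) ⟨hτ, mem_univ q⟩).hasFDerivWithinAt.comp q
      (hasFDerivAt_prodMk_right τ q).hasFDerivWithinAt fun _ _ => ⟨hτ, mem_univ _⟩

theorem continuousOn_fderiv_slice (hs : UniqueDiffOn ℝ s)
    (hf : ContDiffOn ℝ 1 (fun z : ℝ × E => f z.1 z.2) (s ×ˢ univ)) :
    ContinuousOn (fun z : ℝ × E => fderiv ℝ (f z.1) z.2) (s ×ˢ univ) :=
  ((hf.continuousOn_fderivWithin (hs.prod uniqueDiffOn_univ) le_rfl).clm_comp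
    continuousOn_const).congr fun z hz =>
      (hasFDerivAt_slice (hf.differentiableOn one_ne_zero) hz.1 z.2).fderiv

end Slice

section TimeIntegral

variable {E : Type*}

theorem convexOn_intervalIntegral [AddCommGroup E] [Module ℝ E] {D : Set E} {H : ℝ → E → ℝ}
    {a b : ℝ} (hD : Convex ℝ D) (hab : a ≤ b)
    (hint : ∀ q, IntervalIntegrable (fun τ => H τ q) volume a b)
    (hconv : ∀ τ ∈ Ioo a b, ConvexOn ℝ D (H τ)) : ConvexOn ℝ D fun q => ∫ τ in a..b, H τ q := by
  refine ⟨hD, fun p hp q hq r s hr hs hrs => ?_⟩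
  simp only [smul_eq_mul, ← intervalIntegral.integral_const_mul]
  rw [← intervalIntegral.integral_add ((hint p).const_mul r) ((hint q).const_mul s)]
  exact intervalIntegral.integral_mono_on_of_le_Ioo hab (hint _)
    (((hint p).const_mul r).add ((hint q).const_mul s)) fun τ hτ =>
    (hconv τ hτ).2 hp hq hr hs hrs

theorem integral_nonneg_of_forall_Ioo {g : ℝ → ℝ} {a b : ℝ} (hab : a ≤ b)
    (hint : IntervalIntegrable g volume a b) (hg : ∀ τ ∈ Ioo a b, 0 ≤ g τ) :
    0 ≤ ∫ τ in a..b, g τ := by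
  simpa using intervalIntegral.integral_mono_on_of_le_Ioo hab
    (intervalIntegrable_const (c := (0 : ℝ))) hint hg

-- The factors of a separable function need not be measurable; these ones are built from its slices.
theorem exists_intervalIntegrable_separation [Nonempty E] {H : ℝ → E → ℝ} {g k : ℝ → ℝ} {h : E → ℝ}
    {a b : ℝ} (hint : ∀ q, IntervalIntegrable (fun τ => H τ q) volume a b)
    (hg : ∀ τ ∈ Ioo a b, 0 ≤ g τ) (hH : ∀ τ ∈ Ioo a b, ∀ q, H τ q = g τ * h q + k τ) :
    ∃ (g' k' : ℝ → ℝ) (h' : E → ℝ), IntervalIntegrable g' volume a b ∧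
      IntervalIntegrable k' volume a b ∧ (∀ τ ∈ Ioo a b, 0 ≤ g' τ) ∧
      ∀ τ ∈ Ioo a b, ∀ q, H τ q = g' τ * h' q + k' τ := by
  obtain ⟨q₀⟩ := ‹Nonempty E›
  by_cases hconst : ∀ q, h q = h q₀
  · exact ⟨0, fun τ => H τ q₀, h, intervalIntegrable_const (c := (0 : ℝ)), hint q₀,
      fun _ _ => le_rfl, fun τ hτ q => by simp [hH τ hτ, hconst q]⟩
  push Not at hconst
  obtain ⟨q₁, hq₁⟩ := hconst
  have hq₁' := sub_ne_zero.2 hq₁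
  have hg_eq : ∀ τ ∈ Ioo a b, (H τ q₁ - H τ q₀) / (h q₁ - h q₀) = g τ := fun τ hτ => by
    rw [div_eq_iff hq₁', hH τ hτ, hH τ hτ]
    ring
  refine ⟨fun τ => (H τ q₁ - H τ q₀) / (h q₁ - h q₀), fun τ => H τ q₀, fun q => h q - h q₀,
    ((hint q₁).sub (hint q₀)).div_const _, hint q₀,
    fun τ hτ => (hg τ hτ).trans_eq (hg_eq τ hτ).symm, fun τ hτ q => ?_⟩
  beta_reduce
  rw [hg_eq τ hτ, hH τ hτ, hH τ hτ]
  ring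

theorem exists_integral_eq_mul_add {H : ℝ → E → ℝ} {g k : ℝ → ℝ} {h : E → ℝ} {a b s : ℝ}
    (hs : s ∈ Icc a b) (hg_int : IntervalIntegrable g volume a b)
    (hk_int : IntervalIntegrable k volume a b) (hg : ∀ τ ∈ Ioo a b, 0 ≤ g τ)
    (hH : ∀ τ ∈ Ioo a b, ∀ q, H τ q = g τ * h q + k τ) :
    ∃ θ ∈ Icc (0 : ℝ) 1, ∃ c, ∀ q, ∫ τ in a..s, H τ q = θ * (∫ τ in a..b, H τ q) + c := by
  have hs_uIcc : s ∈ uIcc a b := Icc_subset_uIcc hs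
  have hleft : uIcc a s ⊆ uIcc a b := uIcc_subset_uIcc_left hs_uIcc
  have hright : uIcc s b ⊆ uIcc a b := uIcc_subset_uIcc_right hs_uIcc
  have hH_integral : ∀ r ∈ Icc a b, ∀ q, ∫ τ in a..r, H τ q =
      (∫ τ in a..r, g τ) * h q + ∫ τ in a..r, k τ := fun r hr q => by
    have hsub : uIcc a r ⊆ uIcc a b := uIcc_subset_uIcc_left (Icc_subset_uIcc hr)
    rw [← intervalIntegral.integral_mul_const, ← intervalIntegral.integral_add
      ((hg_int.mono_set hsub).mul_const _) (hk_int.mono_set hsub)]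
    exact intervalIntegral.integral_congr_Ioo_of_le hr.1 fun τ hτ =>
      hH τ (Ioo_subset_Ioo_right hr.2 hτ) q
  set m : ℝ → ℝ := fun r => ∫ τ in a..r, g τ
  have hm_nonneg : 0 ≤ m s := integral_nonneg_of_forall_Ioo hs.1 (hg_int.mono_set hleft)
    fun τ hτ => hg τ (Ioo_subset_Ioo_right hs.2 hτ)
  have hm_le : m s ≤ m b := by
    have hadd : m s + ∫ τ in s..b, g τ = m b := intervalIntegral.integral_add_adjacent_intervals
      (hg_int.mono_set hleft) (hg_int.mono_set hright)
    have hrest : 0 ≤ ∫ τ in s..b, g τ := integral_nonneg_of_forall_Ioo hs.2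
      (hg_int.mono_set hright) fun τ hτ => hg τ (Ioo_subset_Ioo_left hs.1 hτ)
    linarith
  have hθ : m s / m b * m b = m s :=
    div_mul_cancel_of_imp fun hb => le_antisymm (hb ▸ hm_le) hm_nonneg
  refine ⟨m s / m b, ⟨div_nonneg hm_nonneg (hm_nonneg.trans hm_le),
    div_le_one_of_le₀ hm_le (hm_nonneg.trans hm_le)⟩,
    (∫ τ in a..s, k τ) - m s / m b * ∫ τ in a..b, k τ, fun q => ?_⟩
  rw [hH_integral s hs, hH_integral b ⟨hs.1.trans hs.2, le_rfl⟩]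
  linear_combination -h q * hθ

theorem exists_convexOn_integral_sub_of_separable [AddCommGroup E] [Module ℝ E] {H : ℝ → E → ℝ}
    {g k : ℝ → ℝ} {h : E → ℝ} {a b s : ℝ} (hs : s ∈ Icc a b)
    (hint : ∀ q, IntervalIntegrable (fun τ => H τ q) volume a b)
    (hg : ∀ τ ∈ Ioo a b, 0 ≤ g τ) (hH : ∀ τ ∈ Ioo a b, ∀ q, H τ q = g τ * h q + k τ) :
    ∃ θ ∈ Icc (0 : ℝ) 1, ConvexOn ℝ univ fun q =>
      (∫ τ in a..s, H τ q) - θ * ∫ τ in a..b, H τ q := by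
  obtain ⟨g', k', h', hg_int, hk_int, hg', hH'⟩ := exists_intervalIntegrable_separation hint hg hH
  obtain ⟨θ, hθ, c, hc⟩ := exists_integral_eq_mul_add hs hg_int hk_int hg' hH'
  refine ⟨θ, hθ, (convexOn_const c convex_univ).congr fun q _ => ?_⟩
  rw [hc q, add_sub_cancel_left]

section Smooth

variable {T : ℝ} {H : ℝ → E → ℝ}

theorem intervalIntegrable_slice [TopologicalSpace E]
    (hH : ContinuousOn (fun z : ℝ × E => H z.1 z.2) (Icc 0 T ×ˢ univ)) {s t : ℝ}
    (hs : s ∈ Icc 0 T) (ht : t ∈ Icc 0 T) (q : E) :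
    IntervalIntegrable (fun τ => H τ q) volume s t :=
  ((continuousOn_slice hH q).mono (uIcc_subset_Icc hs ht)).intervalIntegrable

theorem continuousOn_timeIntegral [TopologicalSpace E]
    (hH : ContinuousOn (fun z : ℝ × E => H z.1 z.2) (Icc 0 T ×ˢ univ)) :
    ContinuousOn (fun z : ℝ × E => ∫ τ in (0 : ℝ)..z.1, H τ z.2) (Icc 0 T ×ˢ univ) := by
  rcases lt_or_ge T 0 with hT | hT
  · simp [Icc_eq_empty_of_lt hT]
  have hext : Continuous fun w : (ℝ × E) × ℝ => H (projIcc 0 T hT w.2) w.1.2 :=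
    hH.comp_continuous (f := fun w : (ℝ × E) × ℝ => ((projIcc 0 T hT w.2 : ℝ), w.1.2))
      ((continuous_subtype_val.comp (continuous_projIcc.comp continuous_snd)).prodMk
        (continuous_snd.comp continuous_fst))
      fun w => ⟨(projIcc 0 T hT w.2).2, mem_univ _⟩
  have hint : Continuous fun z : ℝ × E => ∫ τ in (0 : ℝ)..z.1, H (projIcc 0 T hT τ) z.2 :=
    intervalIntegral.continuous_parametric_intervalIntegral_of_continuous
      (f := fun (z : ℝ × E) τ => H (projIcc 0 T hT τ) z.2) hext continuous_fst
  refine hint.continuousOn.congr fun z hz => ?_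
  refine intervalIntegral.integral_congr fun τ hτ => ?_
  simp only [projIcc_of_mem hT (uIcc_subset_Icc ⟨le_rfl, hT⟩ hz.1 hτ)]

theorem differentiable_timeIntegral [NormedAddCommGroup E] [NormedSpace ℝ E] [ProperSpace E]
    (hH : ContinuousOn (fun z : ℝ × E => H z.1 z.2) (Icc 0 T ×ˢ univ))
    (hHd : ∀ τ ∈ Icc 0 T, Differentiable ℝ (H τ))
    (hHd' : ContinuousOn (fun z : ℝ × E => fderiv ℝ (H z.1) z.2) (Icc 0 T ×ˢ univ))
    {t : ℝ} (ht : t ∈ Icc 0 T) : Differentiable ℝ fun q => ∫ τ in (0 : ℝ)..t, H τ q := by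
  have h0 : (0 : ℝ) ∈ Icc 0 T := ⟨le_rfl, ht.1.trans ht.2⟩
  have hsub : uIoc 0 t ⊆ Icc 0 T := uIoc_subset_uIcc.trans (uIcc_subset_Icc h0 ht)
  intro q
  obtain ⟨C, hC⟩ := (isCompact_Icc.prod (isCompact_closedBall q 1)).exists_bound_of_continuousOn
    (hHd'.mono (prod_mono_right (subset_univ _)))
  exact (intervalIntegral.hasFDerivAt_integral_of_dominated_of_fderiv_le
    (F := fun q τ => H τ q) (F' := fun q τ => fderiv ℝ (H τ) q) (bound := fun _ => C)
    (Metric.closedBall_mem_nhds q one_pos)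
    (Eventually.of_forall fun p => (intervalIntegrable_slice hH h0 ht p).def'.aestronglyMeasurable)
    (intervalIntegrable_slice hH h0 ht q)
    (((continuousOn_slice hHd' q).mono hsub).aestronglyMeasurable measurableSet_uIoc)
    (Eventually.of_forall fun τ hτ p hp => hC (τ, p) ⟨hsub hτ, hp⟩)
    intervalIntegrable_const
    (Eventually.of_forall fun τ hτ p _ => (hHd τ (hsub hτ) p).hasFDerivAt)).differentiableAt

end Smooth

end TimeIntegral

section HopfFunctional

variable {E : Type*} [NormedAddCommGroup E] [InnerProductSpace ℝ E] {T : ℝ} {H : ℝ → E → ℝ}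

/-- The value at `q` of the Hopf functional `φ(t, x, ·)`, `z = (t, x)`, without its conjugate
term. -/
noncomputable def hopfAction (H : ℝ → E → ℝ) (z : ℝ × E) (q : E) : ℝ :=
  ⟪z.2, q⟫ - ∫ τ in (0 : ℝ)..z.1, H τ q

theorem continuousOn_hopfAction
    (hH : ContinuousOn (fun z : ℝ × E => H z.1 z.2) (Icc 0 T ×ˢ univ)) :
    ContinuousOn (fun w : (ℝ × E) × E => hopfAction H w.1 w.2) ((Icc 0 T ×ˢ univ) ×ˢ univ) := by
  have hint : ContinuousOn (fun w : (ℝ × E) × E => ∫ τ in (0 : ℝ)..w.1.1, H τ w.2)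
      ((Icc 0 T ×ˢ univ) ×ˢ univ) :=
    (continuousOn_timeIntegral hH).comp (f := fun w : (ℝ × E) × E => (w.1.1, w.2)) (by fun_prop)
      fun _ hw => ⟨hw.1.1, mem_univ _⟩
  unfold hopfAction
  fun_prop

theorem hasFDerivAt_hopfAction
    (hH : ContinuousOn (fun z : ℝ × E => H z.1 z.2) (Icc 0 T ×ˢ univ)) {z : ℝ × E}
    (hz : z.1 ∈ Ioo 0 T) (q : E) :
    HasFDerivAt (fun w => hopfAction H w q)
      (innerSL ℝ q ∘L ContinuousLinearMap.snd ℝ ℝ E -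
        H z.1 q • ContinuousLinearMap.fst ℝ ℝ E) z := by
  have hinner : HasFDerivAt (fun w : ℝ × E => ⟪w.2, q⟫)
      (innerSL ℝ q ∘L ContinuousLinearMap.snd ℝ ℝ E) z := by
    simp only [real_inner_comm q]
    exact (innerSL ℝ q ∘L ContinuousLinearMap.snd ℝ ℝ E).hasFDerivAt
  have hslice : ContinuousOn (fun τ => H τ q) (Ioo 0 T) :=
    (continuousOn_slice hH q).mono Ioo_subset_Icc_self
  have hint : HasDerivAt (fun t => ∫ τ in (0 : ℝ)..t, H τ q) (H z.1 q) z.1 :=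
    intervalIntegral.integral_hasDerivAt_right
      (intervalIntegrable_slice hH ⟨le_rfl, (hz.1.trans hz.2).le⟩ (Ioo_subset_Icc_self hz) q)
      (hslice.stronglyMeasurableAtFilter isOpen_Ioo _ hz)
      (hslice.continuousAt (isOpen_Ioo.mem_nhds hz))
  exact hinner.sub (hint.comp_hasFDerivAt z hasFDerivAt_fst)

theorem contDiffOn_hopfAction_sub {D : Set E} {f : E → ℝ} {P : ℝ × E → E}
    (hH : ContinuousOn (fun z : ℝ × E => H z.1 z.2) (Icc 0 T ×ˢ univ))
    (hP : ∀ z ∈ Ioo 0 T ×ˢ univ, P z ∈ argmaxOn D fun q => hopfAction H z q - f q)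
    (hPc : ContinuousOn P (Ioo 0 T ×ˢ univ)) :
    ContDiffOn ℝ 1 (fun z => hopfAction H z (P z) - f (P z)) (Ioo 0 T ×ˢ univ) := by
  refine contDiffOn_of_mem_argmaxOn (Φ := fun z q => hopfAction H z q - f q)
    (isOpen_Ioo.prod isOpen_univ)
    (fun z hz q _ => (hasFDerivAt_hopfAction hH hz.1 q).sub_const (f q)) ?_ hP hPc
  have hH_comp : ContinuousOn (fun w : (ℝ × E) × E => H w.1.1 w.2) ((Ioo 0 T ×ˢ univ) ×ˢ D) :=
    hH.comp (f := fun w : (ℝ × E) × E => (w.1.1, w.2)) (by fun_prop)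
      fun _ hw => ⟨Ioo_subset_Icc_self hw.1.1, mem_univ _⟩
  exact (((innerSL ℝ).continuous.comp continuous_snd).clm_comp continuous_const).continuousOn.sub
    (hH_comp.smul continuousOn_const)

end HopfFunctional

section Hopf

variable {n : ℕ} {T : ℝ} {H : ℝ → EuclideanSpace ℝ (Fin n) → ℝ}
  {σ : EuclideanSpace ℝ (Fin n) → ℝ} {t : ℝ} {x p q : EuclideanSpace ℝ (Fin n)}

theorem CondA2.mono {T' : ℝ} (hA2 : CondA2 T H) (hT : T' ≤ T) : CondA2 T' H := by
  have hsub : Ioo 0 T' ⊆ Ioo 0 T := Ioo_subset_Ioo_right hT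
  rcases hA2 with (hconvex | hconcave) | ⟨g, h, k, hsep, hg⟩
  · exact .inl (.inl fun t ht => hconvex t (hsub ht))
  · exact .inl (.inr fun t ht => hconcave t (hsub ht))
  · exact .inr ⟨g, h, k, fun t ht => hsep t (hsub ht),
      hg.imp (fun hg t ht => hg t (hsub ht)) fun hg t ht => hg t (hsub ht)⟩

theorem exists_convexOn_timeIntegral_sub {s : ℝ} (hA2 : CondA2 T H)
    (hint : ∀ q, IntervalIntegrable (fun τ => H τ q) volume 0 T) (hs : s ∈ Icc 0 T) :
    ∃ θ ∈ Icc (0 : ℝ) 1, ConvexOn ℝ univ fun q =>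
      (∫ τ in (0 : ℝ)..s, H τ q) - θ * ∫ τ in (0 : ℝ)..T, H τ q := by
  have hs_uIcc : s ∈ uIcc 0 T := Icc_subset_uIcc hs
  have hint_left : ∀ q, IntervalIntegrable (fun τ => H τ q) volume 0 s := fun q =>
    (hint q).mono_set (uIcc_subset_uIcc_left hs_uIcc)
  rcases hA2 with (hconvex | hconcave) | ⟨g, h, k, hH, hg | hg⟩
  · refine ⟨0, ⟨le_rfl, zero_le_one⟩, ?_⟩
    simpa only [zero_mul, sub_zero] using convexOn_intervalIntegral convex_univ hs.1 hint_left
      fun τ hτ => hconvex τ (Ioo_subset_Ioo_right hs.2 hτ)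
  · refine ⟨1, ⟨zero_le_one, le_rfl⟩, (convexOn_intervalIntegral (H := fun τ q => -H τ q)
      convex_univ hs.2 (fun q => ((hint q).mono_set (uIcc_subset_uIcc_right hs_uIcc)).neg)
      fun τ hτ => (hconcave τ (Ioo_subset_Ioo_left hs.1 hτ)).neg).congr fun q _ => ?_⟩
    beta_reduce
    rw [intervalIntegral.integral_neg, one_mul,
      ← intervalIntegral.integral_interval_sub_left (hint q) (hint_left q), neg_sub]
  · exact exists_convexOn_integral_sub_of_separable hs hint hg hH
  · exact exists_convexOn_integral_sub_of_separable (g := -g) (h := -h) hs hint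
      (fun τ hτ => neg_nonneg.2 (hg τ hτ)) fun τ hτ q => by
        rw [hH τ hτ, Pi.neg_apply, Pi.neg_apply, neg_mul_neg]

theorem coe_le_fenchelConj (σ : EuclideanSpace ℝ (Fin n) → ℝ) (y q : EuclideanSpace ℝ (Fin n)) :
    ((⟪y, q⟫ - σ y : ℝ) : EReal) ≤ fenchelConj σ q :=
  le_iSup (fun y => ((⟪y, q⟫ - σ y : ℝ) : EReal)) y

theorem fenchelConj_eq_coe (hq : q ∈ conjDomain σ) : fenchelConj σ q = (realConj σ q : EReal) := by
  refine le_antisymm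
    (iSup_le fun y => EReal.coe_le_coe_iff.2 (inner_sub_le_realConj hq y)) ?_
  refine EReal.le_of_forall_lt_iff_le.1 fun c hc => EReal.coe_le_coe_iff.2 (ciSup_le fun y => ?_)
  exact EReal.coe_le_coe_iff.1 ((coe_le_fenchelConj σ y q).trans hc.le)

theorem fenchelConj_eq_top (hq : q ∉ conjDomain σ) : fenchelConj σ q = ⊤ := by
  refine EReal.eq_top_iff_forall_lt _ |>.2 fun c => ?_
  by_contra! hle
  exact hq ⟨c, forall_mem_range.2 fun y =>
    EReal.coe_le_coe_iff.1 ((coe_le_fenchelConj σ y q).trans hle)⟩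

theorem hopfPhi_eq_coe (hq : q ∈ conjDomain σ) :
    hopfPhi H σ t x q = ((hopfAction H (t, x) q - realConj σ q : ℝ) : EReal) := by
  rw [hopfPhi, fenchelConj_eq_coe hq, hopfAction, ← EReal.coe_sub]

theorem hopfPhi_eq_bot (hq : q ∉ conjDomain σ) : hopfPhi H σ t x q = ⊥ := by
  rw [hopfPhi, fenchelConj_eq_top hq, EReal.sub_top]

theorem hopfMaximizers_eq_argmaxOn (hne : (conjDomain σ).Nonempty) :
    hopfMaximizers H σ t x =
      argmaxOn (conjDomain σ) fun q => hopfAction H (t, x) q - realConj σ q := by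
  ext p
  refine ⟨fun hp => ?_, fun hp q => ?_⟩
  · obtain ⟨q₀, hq₀⟩ := hne
    have hpD : p ∈ conjDomain σ := by
      by_contra hpD
      have hle := hp q₀
      rw [hopfPhi_eq_bot hpD, hopfPhi_eq_coe hq₀, le_bot_iff] at hle
      exact EReal.coe_ne_bot _ hle
    refine ⟨hpD, fun q hq => ?_⟩
    have hle := hp q
    rwa [hopfPhi_eq_coe hpD, hopfPhi_eq_coe hq, EReal.coe_le_coe_iff] at hle
  · by_cases hq : q ∈ conjDomain σ
    · rw [hopfPhi_eq_coe hp.1, hopfPhi_eq_coe hq]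
      exact EReal.coe_le_coe_iff.2 (hp.2 hq)
    · exact hopfPhi_eq_bot hq ▸ bot_le

theorem coe_hopfU_eq_hopfPhi (hp : p ∈ hopfMaximizers H σ t x) (hpD : p ∈ conjDomain σ) :
    (hopfU H σ t x : EReal) = hopfPhi H σ t x p := by
  have hsup : ⨆ q, hopfPhi H σ t x q = hopfPhi H σ t x p := le_antisymm (iSup_le hp) (le_iSup _ p)
  rw [hopfU, hsup, hopfPhi_eq_coe hpD, EReal.toReal_coe]

theorem exists_hopfMaximizers_eq_singleton (hσ : ConvexOn ℝ univ σ) (hσd : Differentiable ℝ σ)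
    {K : NNReal} (hσK : LipschitzWith K σ)
    (hH : ContinuousOn (fun z : ℝ × EuclideanSpace ℝ (Fin n) => H z.1 z.2) (Icc 0 T ×ˢ univ))
    (hHd : ∀ τ ∈ Icc 0 T, Differentiable ℝ (H τ))
    (hHd' : ContinuousOn (fun z : ℝ × EuclideanSpace ℝ (Fin n) => fderiv ℝ (H z.1) z.2)
      (Icc 0 T ×ˢ univ))
    (hA2 : CondA2 T H) (hsing : ∀ x, ∃ p, hopfMaximizers H σ T x = {p}) (ht : t ∈ Icc 0 T)
    (x : EuclideanSpace ℝ (Fin n)) : ∃ p, hopfMaximizers H σ t x = {p} := by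
  have hT : 0 ≤ T := ht.1.trans ht.2
  have hne : (conjDomain σ).Nonempty := ⟨_, gradient_mem_conjDomain hσ (hσd 0)⟩
  have hdiff : ∀ {s}, s ∈ Icc 0 T → Differentiable ℝ fun q => ∫ τ in (0 : ℝ)..s, H τ q :=
    differentiable_timeIntegral hH hHd hHd'
  have hcombine : ∀ s y, hopfMaximizers H σ s y = argmaxOn (conjDomain σ)
      fun q => ⟪y, q⟫ - (realConj σ q + ∫ τ in (0 : ℝ)..s, H τ q) := fun s y => by
    simp only [hopfMaximizers_eq_argmaxOn hne, hopfAction, sub_add_eq_sub_sub_swap]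
  obtain ⟨θ, hθ, hconvex⟩ := exists_convexOn_timeIntegral_sub hA2
    (intervalIntegrable_slice hH ⟨le_rfl, hT⟩ ⟨hT, le_rfl⟩) ht
  have hunique : (hopfMaximizers H σ t x).Subsingleton := hcombine t x ▸
    subsingleton_argmaxOn_conj_of_later hσ hσd hσK (hdiff ht) (hdiff ⟨hT, le_rfl⟩) hθ hconvex
      (fun y => by simpa only [hcombine] using hsing y) x
  have hexists : (hopfMaximizers H σ t x).Nonempty := by
    rw [hopfMaximizers_eq_argmaxOn hne]
    exact argmaxOn_sub_nonempty (isClosed_epigraphOn_realConj σ) (isCompact_closedBall 0 K)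
      (fun q hq => mem_closedBall_zero_iff.2 (norm_le_of_mem_conjDomain hσK hq)) hne
      ((continuous_const.inner continuous_id).sub (hdiff ht).continuous)
  exact exists_eq_singleton_iff_nonempty_subsingleton.2 ⟨hexists, hunique⟩

theorem theorem3p2_general
    (hH : ContinuousOn (fun z : ℝ × EuclideanSpace ℝ (Fin n) => H z.1 z.2) (Icc 0 T ×ˢ univ))
    (hHd : ∀ τ ∈ Icc 0 T, Differentiable ℝ (H τ))
    (hHd' : ContinuousOn (fun z : ℝ × EuclideanSpace ℝ (Fin n) => fderiv ℝ (H z.1) z.2)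
      (Icc 0 T ×ˢ univ))
    (hσd : Differentiable ℝ σ) (hσ : ConvexOn ℝ univ σ) (hA2 : CondA2 T H)
    (hσLip : ∃ K : NNReal, LipschitzWith K σ)
    (hsing : ∀ x, ∃ p, hopfMaximizers H σ T x = {p}) :
    (∀ t ∈ Ioo 0 T, ∀ x, IsGreatest (range (hopfPhi H σ t x)) (hopfU H σ t x : EReal)) ∧
    ContDiffOn ℝ 1 (fun z : ℝ × EuclideanSpace ℝ (Fin n) => hopfU H σ z.1 z.2)
      (Ioo 0 T ×ˢ univ) := by
  obtain ⟨K, hσK⟩ := hσLip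
  have hne : (conjDomain σ).Nonempty := ⟨_, gradient_mem_conjDomain hσ (hσd 0)⟩
  have hmax : ∀ z ∈ Ioo 0 T ×ˢ univ, ∃ p, hopfMaximizers H σ z.1 z.2 = {p} := fun z hz =>
    exists_hopfMaximizers_eq_singleton hσ hσd hσK hH hHd hHd' hA2 hsing
      (Ioo_subset_Icc_self hz.1) z.2
  choose! P hP using hmax
  have hP_mem : ∀ z ∈ Ioo 0 T ×ˢ univ, P z ∈ hopfMaximizers H σ z.1 z.2 := fun z hz =>
    hP z hz ▸ mem_singleton (P z)
  simp only [hopfMaximizers_eq_argmaxOn hne] at hP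
  have hP_argmax : ∀ z ∈ Ioo 0 T ×ˢ univ,
      P z ∈ argmaxOn (conjDomain σ) fun q => hopfAction H z q - realConj σ q := fun z hz =>
    hP z hz ▸ mem_singleton (P z)
  have hU : ∀ z ∈ Ioo 0 T ×ˢ univ, (hopfU H σ z.1 z.2 : EReal) = hopfPhi H σ z.1 z.2 (P z) :=
    fun z hz => coe_hopfU_eq_hopfPhi (hP_mem z hz) (hP_argmax z hz).1
  have hP_cont : ContinuousOn P (Ioo 0 T ×ˢ univ) :=
    continuousOn_argmaxOn_sub (isClosed_epigraphOn_realConj σ) (isCompact_closedBall 0 K)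
      (fun q hq => mem_closedBall_zero_iff.2 (norm_le_of_mem_conjDomain hσK hq))
      ((continuousOn_hopfAction hH).mono
        (prod_mono_left (prod_mono_left Ioo_subset_Icc_self))) hP
  refine ⟨fun t ht x => ?_, (contDiffOn_hopfAction_sub hH hP_argmax hP_cont).congr
    fun z hz => ?_⟩
  · rw [hU (t, x) ⟨ht, mem_univ x⟩]
    exact ⟨mem_range_self _, forall_mem_range.2 (hP_mem (t, x) ⟨ht, mem_univ x⟩)⟩
  · exact EReal.coe_injective ((hU z hz).trans (hopfPhi_eq_coe (hP_argmax z hz).1))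

end Hopf

theorem theorem3p2 {n : ℕ} (T : ℝ) (hT : 0 < T)
    (H : ℝ → EuclideanSpace ℝ (Fin n) → ℝ) (σ : EuclideanSpace ℝ (Fin n) → ℝ)
    (hH : ContDiffOn ℝ 1 (fun z : ℝ × EuclideanSpace ℝ (Fin n) => H z.1 z.2)
      (Set.Icc 0 T ×ˢ Set.univ))
    (hσ : ContDiff ℝ 1 σ) (hσconv : ConvexOn ℝ Set.univ σ)
    (hA1 : CondA1 T H σ) (hA2 : CondA2 T H)
    (hσLip : ∃ K : NNReal, LipschitzWith K σ)
    (tstar : ℝ) (htpos : 0 < tstar) (htT : tstar ≤ T)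
    (hsing : ∀ x : EuclideanSpace ℝ (Fin n), ∃ p, hopfMaximizers H σ tstar x = {p}) :
    (∀ t ∈ Set.Ioo 0 tstar, ∀ x : EuclideanSpace ℝ (Fin n),
      IsGreatest (Set.range (hopfPhi H σ t x)) (hopfU H σ t x : EReal)) ∧
    ContDiffOn ℝ 1 (fun z : ℝ × EuclideanSpace ℝ (Fin n) => hopfU H σ z.1 z.2)
      (Set.Ioo 0 tstar ×ˢ Set.univ) := by
  have hslice := hH.mono (prod_mono_left (Icc_subset_Icc_right htT))
  exact theorem3p2_general hslice.continuousOn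
    (fun τ hτ q => (hasFDerivAt_slice (hslice.differentiableOn one_ne_zero) hτ q).differentiableAt)
    (continuousOn_fderiv_slice (uniqueDiffOn_Icc htpos) hslice)
    (hσ.differentiable one_ne_zero) hσconv (hA2.mono htT) hσLip hsing
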